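/- Let $R$ be a nonzero finite ring with identity, not necessarily commutative, with unit group $R^{\times}$. Let $G_R$ be its unitary Cayley graph: the simple graph with vertex set $R$ in which $a$ and $b$ are adjacent if and only if $a-b\in R^{\times}$. A set $X$ of vertices of a graph $G$ is called homogeneous if every vertex outside $X$ is adjacent to either all or none of the vertices in $X$, and $G$ is called prime if it has no homogeneous set $X$ with $2\le |X|<|V(G)|$. If $G_R$ is prime, then $0$ is not an eigenvalue of $G_R$; that is, the adjacency matrix of $G_R$ is nonsingular. -/

import Mathlib

namespace SimpleGraph

/-- A set `X` of vertices is homogeneous in `G` if every vertex outside `X` is adjacent to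
all or to none of the vertices in `X`. -/
def IsHomogeneousSet {V : Type*} (G : SimpleGraph V) (X : Set V) : Prop :=
  ∀ v, v ∉ X → (∀ x ∈ X, G.Adj v x) ∨ (∀ x ∈ X, ¬ G.Adj v x)

/-- A graph is prime if it has no non-trivial homogeneous set, that is, no homogeneous set
with at least two elements other than the whole vertex set. -/
def IsPrimeGraph {V : Type*} (G : SimpleGraph V) : Prop :=
  ¬ ∃ X : Set V, G.IsHomogeneousSet X ∧ X.Nontrivial ∧ X ≠ Set.univ

end SimpleGraph

/-- The unitary Cayley graph of a (not necessarily commutative) ring `R`: the Cayley graph on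
the additive group of `R` whose generating set is the set of units. -/
def unitaryCayleyGraph (R : Type*) [Ring R] : SimpleGraph R :=
  SimpleGraph.addCayley {u : R | IsUnit u}

/-- Over a nonzero ring, `a` and `b` are adjacent exactly when `a - b` is a unit. -/
theorem unitaryCayleyGraph_adj {R : Type*} [Ring R] [Nontrivial R] (a b : R) :
    (unitaryCayleyGraph R).Adj a b ↔ IsUnit (a - b) := by
  have h1 : -a + b = -(a - b) := by abel
  have h2 : -b + a = a - b := by abel
  rw [unitaryCayleyGraph, SimpleGraph.addCayley_adj, h1, h2]
  simp only [Set.mem_ofPred_eq, IsUnit.neg_iff, or_self, and_iff_right_iff_imp]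
  rintro h rfl
  simp at h

/-! The Jacobson radical is a proper homogeneous set, so primeness makes it zero and `R` is
semisimple. Additive characters form an eigenbasis of the adjacency matrix, the eigenvalue of `χ`
being the sum of `χ` over the units. By Wedderburn these sums factor over matrix rings over finite
fields. There a unit is a matrix with independent rows, and `indepSum_succ` peels off one row at a
time until the sum is, up to sign and a power of the field size, a count of bases. -/

namespace AddChar

variable {K V : Type*} [Field K] [AddCommGroup V] [Module K V]

/-- The largest subspace on which an additive character is trivial. -/
def trivialSubspace (K : Type*) {V : Type*} [Field K] [AddCommGroup V] [Module K V]
    (χ : AddChar V ℂ) : Submodule K V where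
  carrier := {v | ∀ c : K, χ (c • v) = 1}
  add_mem' ha hb c := by rw [smul_add, map_add_eq_mul, ha c, hb c, one_mul]
  zero_mem' c := by simp
  smul_mem' d v hv c := by rw [smul_smul]; exact hv _

theorem mem_trivialSubspace {χ : AddChar V ℂ} {v : V} :
    v ∈ trivialSubspace K χ ↔ ∀ c : K, χ (c • v) = 1 := Iff.rfl

theorem le_trivialSubspace_iff {χ : AddChar V ℂ} {W : Submodule K V} :
    W ≤ trivialSubspace K χ ↔ ∀ w ∈ W, χ w = 1 :=
  ⟨fun h w hw ↦ by simpa using mem_trivialSubspace.1 (h hw) 1,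
    fun h _ hw c ↦ h _ (W.smul_mem c hw)⟩

/-- The sum of an additive character over a subspace. -/
theorem sum_subspace [Finite V] (χ : AddChar V ℂ) (W : Submodule K V) [Fintype W]
    [Decidable (W ≤ trivialSubspace K χ)] :
    ∑ w : W, χ w = if W ≤ trivialSubspace K χ then (Fintype.card W : ℂ) else 0 := by
  classical
  have h := sum_eq_ite (χ.compAddMonoidHom W.subtype.toAddMonoidHom)
  have h0 : χ.compAddMonoidHom W.subtype.toAddMonoidHom = 0 ↔ W ≤ trivialSubspace K χ := by
    rw [le_trivialSubspace_iff, eq_zero_iff]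
    simp
  simp only [h0] at h
  simpa using h

/-- Sending `v` to `c ↦ χ (c • v)` embeds the quotient by the trivial subspace into the character
group of `K`, which has only `|K|` elements. -/
theorem finrank_trivialSubspace [Finite K] [Finite V] {χ : AddChar V ℂ} (hχ : χ ≠ 0) :
    Module.finrank K (trivialSubspace K χ) + 1 = Module.finrank K V := by
  set H := trivialSubspace K χ with hH
  have := Fintype.ofFinite K
  have := Fintype.ofFinite V
  let φ : V →+ AddChar K ℂ :=
    { toFun v := χ.compAddMonoidHom (LinearMap.toSpanSingleton K V v).toAddMonoidHom
      map_zero' := by ext; simp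
      map_add' v w := by ext; simp [map_add_eq_mul] }
  have hker : φ.ker = H.toAddSubgroup := by
    ext v
    rw [AddMonoidHom.mem_ker, eq_zero_iff, Submodule.mem_toAddSubgroup, mem_trivialSubspace]
    simp [φ]
  have hq : 1 < Nat.card K := Finite.one_lt_card
  have h1 : Nat.card (V ⧸ H) ≤ Nat.card K := by
    have e : Nat.card (V ⧸ H) = Nat.card φ.range := by
      have := Nat.card_congr (QuotientAddGroup.quotientKerEquivRange φ).toEquiv
      rw [← this, hker]
      rfl
    rw [e]
    calc Nat.card φ.range ≤ Nat.card (AddChar K ℂ) := Finite.card_subtype_le _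
      _ = Nat.card K := by
        rw [Nat.card_eq_fintype_card, Nat.card_eq_fintype_card, card_eq]
  have h2 : Module.finrank K (V ⧸ H) ≤ 1 := by
    rw [Module.natCard_eq_pow_finrank (K := K)] at h1
    exact (Nat.pow_le_pow_iff_right hq).1 (by simpa using h1)
  have h3 : 0 < Module.finrank K (V ⧸ H) := by
    rw [Module.finrank_pos_iff, Submodule.Quotient.nontrivial_iff]
    intro htop
    obtain ⟨x, hx⟩ := ne_zero_iff.1 hχ
    exact hx (le_trivialSubspace_iff.1 htop.ge x trivial)
  have h4 := H.finrank_quotient_add_finrank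
  omega

/-! ### Character sums over linearly independent families -/

open Classical in
/-- The sum over all linearly independent families of a product of additive characters. -/
noncomputable def indepSum (K : Type*) {V ι : Type*} [Field K] [AddCommGroup V] [Module K V]
    [Fintype V] [Fintype ι] [DecidableEq ι] (χ : ι → AddChar V ℂ) : ℂ :=
  ∑ v : ι → V, if LinearIndependent K v then ∏ i, χ i (v i) else 0

theorem indepSum_comp_equiv [Fintype V] {ι κ : Type*} [Fintype ι] [Fintype κ]
    [DecidableEq ι] [DecidableEq κ] (e : ι ≃ κ)
    (χ : κ → AddChar V ℂ) : indepSum K (χ ∘ e) = indepSum K χ := by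
  classical
  refine Fintype.sum_equiv (e.arrowCongr (Equiv.refl V)) _ _ fun v ↦ ?_
  have hv : e.arrowCongr (Equiv.refl V) v = v ∘ e.symm := rfl
  rw [hv, linearIndependent_equiv e.symm]
  congr 1
  exact Fintype.prod_equiv e _ _ fun i ↦ by simp

theorem indepSum_zero [Fintype V] {ι : Type*} [Fintype ι] [DecidableEq ι]
    (h : Fintype.card ι = Module.finrank K V) :
    indepSum K (0 : ι → AddChar V ℂ) ≠ 0 := by
  classical
  have hb : LinearIndependent K ((Module.finBasis K V).reindex
    (Fintype.equivFinOfCardEq h).symm) := Module.Basis.linearIndependent _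
  have : indepSum K (0 : ι → AddChar V ℂ) =
      (Finset.univ.filter fun v : ι → V ↦ LinearIndependent K v).card := by
    simp [indepSum]
  rw [this, Nat.cast_ne_zero, ← Nat.pos_iff_ne_zero, Finset.card_pos]
  exact ⟨_, by simpa using hb⟩

theorem sum_compl_subspace [Fintype V] {χ : AddChar V ℂ} (hχ : χ ≠ 0) (W : Submodule K V)
    [DecidablePred (· ∉ W)] [Decidable (W ≤ trivialSubspace K χ)] :
    (∑ x : V, if x ∉ W then χ x else 0) =
      if W ≤ trivialSubspace K χ then -(Nat.card W : ℂ) else 0 := by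
  classical
  have h := sum_eq_zero_iff_ne_zero.2 hχ
  rw [← Finset.sum_filter_add_sum_filter_not _ (· ∈ W), Finset.sum_subtype _ (p := (· ∈ W)) (by simp),
    sum_subspace χ W] at h
  rw [← Finset.sum_filter, eq_neg_of_add_eq_zero_right h]
  split_ifs <;> simp

/-- With the other vectors fixed, the first runs over the complement of their span. By
`sum_compl_subspace` this contributes minus the size of the span if they all lie in `H`, and 0
otherwise. -/
theorem indepSum_succ [Fintype V] [Finite K] {n : ℕ} (χ : Fin (n + 1) → AddChar V ℂ) (h : χ 0 ≠ 0)
    (H : Submodule K V) (hH : H = trivialSubspace K (χ 0)) [Fintype H] :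
    indepSum K χ = -(Nat.card K : ℂ) ^ n * indepSum K fun i : Fin n ↦
      (χ i.succ).compAddMonoidHom H.subtype.toAddMonoidHom := by
  classical
  have hLI (w : Fin n → H) : LinearIndependent K (fun i ↦ (w i : V)) ↔ LinearIndependent K w :=
    H.subtype.linearIndependent_iff (Submodule.ker_subtype H)
  have hcard (v : Fin n → V) (hv : LinearIndependent K v) :
      Nat.card (Submodule.span K (Set.range v)) = Nat.card K ^ n := by
    rw [Module.natCard_eq_pow_finrank (K := K), finrank_span_eq_card hv, Fintype.card_fin]
  calc indepSum K χ = ∑ v : Fin n → V, if LinearIndependent K v then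
        (∏ i, χ i.succ (v i)) * ∑ x : V,
          (if x ∉ Submodule.span K (Set.range v) then χ 0 x else 0) else 0 := by
        rw [indepSum, ← (Fin.consEquiv fun _ : Fin (n + 1) ↦ V).sum_comp, Fintype.sum_prod_type_right]
        refine Finset.sum_congr rfl fun v _ ↦ ?_
        have hc (x : V) : Fin.consEquiv (fun _ : Fin (n + 1) ↦ V) (x, v) = Fin.cons x v := rfl
        simp only [hc, linearIndependent_finCons, Fin.prod_univ_succ, Fin.cons_zero,
          Fin.cons_succ]
        split_ifs with hv
        · simp only [hv, true_and, Finset.mul_sum, mul_ite, mul_zero,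
            mul_comm (χ 0 _)]
        · simp [hv]
    _ = ∑ v : Fin n → V, if ∀ i, v i ∈ H then (if LinearIndependent K v then
        -(Nat.card K : ℂ) ^ n * ∏ i, χ i.succ (v i) else 0) else 0 := by
        refine Finset.sum_congr rfl fun v _ ↦ ?_
        rw [sum_compl_subspace h, ← hH, Submodule.span_le, Set.range_subset_iff]
        by_cases hv : LinearIndependent K v
        · simp only [hv, if_true, hcard v hv, mul_ite, mul_zero]
          push_cast
          simp only [mul_comm]
          rfl
        · simp [hv]
    _ = ∑ w : Fin n → H, if LinearIndependent K w then
        -(Nat.card K : ℂ) ^ n * ∏ i, χ i.succ (w i) else 0 := by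
        rw [← Finset.sum_filter, Finset.sum_subtype _ (p := fun v ↦ ∀ i, v i ∈ H) (by simp)]
        refine Fintype.sum_equiv Equiv.subtypePiEquivPi _ _ fun v ↦ ?_
        rw [← hLI]
        rfl
    _ = _ := by
        rw [indepSum, Finset.mul_sum]
        simp only [mul_ite, mul_zero]
        rfl

theorem indepSum_ne_zero [Finite K] (n : ℕ) {V : Type*} [AddCommGroup V] [Module K V] [Fintype V]
    (hn : Module.finrank K V = n) (χ : Fin n → AddChar V ℂ) : indepSum K χ ≠ 0 := by
  classical
  induction n generalizing V with
  | zero =>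
    rw [Subsingleton.elim χ 0]
    exact indepSum_zero (by simp [hn])
  | succ n ih =>
    by_cases h0 : χ = 0
    · rw [h0]
      exact indepSum_zero (by simp [hn])
    obtain ⟨j, hj⟩ := Function.ne_iff.1 h0
    -- Move a nontrivial character to index 0; the induction continues in its hyperplane.
    rw [← indepSum_comp_equiv (Equiv.swap 0 j) χ]
    have hj' : (χ ∘ Equiv.swap 0 j) 0 ≠ 0 := by simpa using hj
    have := Fintype.ofFinite (trivialSubspace K ((χ ∘ Equiv.swap 0 j) 0))
    rw [indepSum_succ _ hj' _ rfl]
    refine mul_ne_zero (neg_ne_zero.2 (pow_ne_zero _ ?_)) (ih ?_ _)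
    · exact_mod_cast Nat.card_pos.ne'
    · have := finrank_trivialSubspace (K := K) hj'
      omega

/-! ### Character sums over units -/

/-- An additive character of a matrix ring over a finite field has nonzero sum over the units. -/
theorem sum_isUnit_matrix_ne_zero {K : Type*} [Field K] [Finite K] {n : ℕ}
    [Fintype (Matrix (Fin n) (Fin n) K)]
    [DecidablePred fun M : Matrix (Fin n) (Fin n) K ↦ IsUnit M]
    (χ : AddChar (Matrix (Fin n) (Fin n) K) ℂ) :
    (∑ M, if IsUnit M then χ M else 0) ≠ 0 := by
  classical
  have := Fintype.ofFinite K
  let r (i : Fin n) : (Fin n → K) →+ Matrix (Fin n) (Fin n) K :=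
    AddMonoidHom.single (fun _ : Fin n ↦ Fin n → K) i
  have hr (M : Matrix (Fin n) (Fin n) K) : χ M = ∏ i, χ (r i (M i)) := by
    have hs (s : Finset (Fin n)) (g : Fin n → Matrix (Fin n) (Fin n) K) :
        χ (∑ i ∈ s, g i) = ∏ i ∈ s, χ (g i) := by
      induction s using Finset.induction_on with
      | empty => simp
      | insert a s ha ih => rw [Finset.sum_insert ha, Finset.prod_insert ha, map_add_eq_mul, ih]
    rw [← hs]
    exact congrArg χ (Finset.univ_sum_single M).symm
  convert indepSum_ne_zero (K := K) n (V := Fin n → K) (by simp)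
    fun i ↦ χ.compAddMonoidHom (r i) using 1
  refine Fintype.sum_equiv Matrix.of.symm _ _ fun M ↦ ?_
  have : IsUnit M ↔ LinearIndependent K (Matrix.of.symm M) :=
    Matrix.linearIndependent_rows_iff_isUnit.symm
  simp only [this, hr M]
  rfl

theorem sum_isUnit_pi_ne_zero {ι : Type*} [Finite ι] {A : ι → Type*} [∀ i, Ring (A i)]
    [∀ i, Fintype (A i)] [Fintype (∀ i, A i)]
    [DecidablePred fun x : ∀ i, A i ↦ IsUnit x] [∀ i, DecidablePred fun x : A i ↦ IsUnit x]
    (h : ∀ i (χ : AddChar (A i) ℂ), (∑ x, if IsUnit x then χ x else 0) ≠ 0)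
    (χ : AddChar (∀ i, A i) ℂ) : (∑ x, if IsUnit x then χ x else 0) ≠ 0 := by
  classical
  have := Fintype.ofFinite ι
  let ψ (i : ι) : AddChar (A i) ℂ := χ.compAddMonoidHom (AddMonoidHom.single A i)
  have hχ (x : ∀ i, A i) : χ x = ∏ i, ψ i (x i) := by
    have hs (s : Finset ι) (g : ι → ∀ i, A i) : χ (∑ i ∈ s, g i) = ∏ i ∈ s, χ (g i) := by
      induction s using Finset.induction_on with
      | empty => simp
      | insert a s ha ih => rw [Finset.sum_insert ha, Finset.prod_insert ha, map_add_eq_mul, ih]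
    conv_lhs => rw [← Finset.univ_sum_single x, hs]
    rfl
  have : (∑ x, if IsUnit x then χ x else 0) =
      ∏ i, ∑ x : A i, if IsUnit x then ψ i x else 0 := by
    rw [Finset.prod_univ_sum, Fintype.piFinset_univ]
    refine Finset.sum_congr (by ext; simp) fun x _ ↦ ?_
    rw [Finset.prod_ite_zero, hχ]
    simp [Pi.isUnit_iff]
  rw [this]
  exact Finset.prod_ne_zero_iff.2 fun i _ ↦ h i _

/-- An additive character of a finite semisimple ring has nonzero sum over the units. -/
theorem sum_isUnit_ne_zero {R : Type*} [Ring R] [Fintype R] [IsSemisimpleRing R]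
    [DecidablePred fun x : R ↦ IsUnit x] (χ : AddChar R ℂ) :
    (∑ x, if IsUnit x then χ x else 0) ≠ 0 := by
  classical
  obtain ⟨n, D, d, _, hd, ⟨e⟩⟩ := IsSemisimpleRing.exists_ringEquiv_pi_matrix_divisionRing R
  have hfin : Finite (∀ i, Matrix (Fin (d i)) (Fin (d i)) (D i)) := Finite.of_equiv R e.toEquiv
  have hfin' (i) : Finite (Matrix (Fin (d i)) (Fin (d i)) (D i)) :=
    Finite.of_surjective (fun f : ∀ i, Matrix (Fin (d i)) (Fin (d i)) (D i) ↦ f i)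
      (Function.surjective_eval i)
  have hD (i) : Finite (D i) := Finite.of_surjective
    (fun M : Matrix (Fin (d i)) (Fin (d i)) (D i) ↦ M 0 0) fun x ↦ ⟨fun _ _ ↦ x, rfl⟩
  have := Fintype.ofFinite (∀ i, Matrix (Fin (d i)) (Fin (d i)) (D i))
  have (i : Fin n) := Fintype.ofFinite (Matrix (Fin (d i)) (Fin (d i)) (D i))
  -- Each `D i` is a field by Wedderburn's little theorem.
  have key := sum_isUnit_pi_ne_zero (A := fun i ↦ Matrix (Fin (d i)) (Fin (d i)) (D i))
    (fun i χ ↦ sum_isUnit_matrix_ne_zero (K := D i) χ)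
    (χ.compAddMonoidHom e.symm.toRingHom.toAddMonoidHom)
  convert key using 1
  refine Fintype.sum_equiv e.toEquiv _ _ fun x ↦ ?_
  simp

end AddChar

/-! ### The Jacobson radical and the spectrum -/

/-- In a finite ring, adding an element of the Jacobson radical to a unit gives a unit. -/
theorem IsUnit.add_mem_jacobson {R : Type*} [Ring R] [Finite R] {u x : R} (hu : IsUnit u)
    (hx : x ∈ Ring.jacobson R) : IsUnit (u + x) := by
  obtain ⟨u, rfl⟩ := hu
  rw [← Ideal.jacobson_bot, Ideal.mem_jacobson_iff] at hx
  obtain ⟨z, hz⟩ := hx ↑u⁻¹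
  have h1 : z * (1 + ↑u⁻¹ * x) = 1 := by
    rw [← sub_eq_zero, ← Ideal.mem_bot.1 hz]
    noncomm_ring
  have h2 : (u : R) + x = u * (1 + ↑u⁻¹ * x) := by
    rw [mul_add, mul_one, Units.mul_inv_cancel_left]
  rw [h2]
  -- Finiteness turns the left inverse `z` into a two-sided one.
  exact u.isUnit.mul (.of_mul_eq_one_right z h1)

theorem isHomogeneousSet_jacobson (R : Type*) [Ring R] [Nontrivial R] [Finite R] :
    (unitaryCayleyGraph R).IsHomogeneousSet (Ring.jacobson R : Set R) := by
  intro v _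
  simp only [unitaryCayleyGraph_adj]
  by_cases hv : IsUnit v
  · refine Or.inl fun x hx ↦ ?_
    rw [sub_eq_add_neg]
    exact hv.add_mem_jacobson (neg_mem hx)
  · refine Or.inr fun x hx h ↦ hv ?_
    simpa using h.add_mem_jacobson hx

theorem jacobson_eq_bot_of_isPrimeGraph {R : Type*} [Ring R] [Nontrivial R] [Finite R]
    (h : (unitaryCayleyGraph R).IsPrimeGraph) : Ring.jacobson R = ⊥ := by
  by_contra hJ
  refine h ⟨_, isHomogeneousSet_jacobson R, ?_, fun htop ↦ ?_⟩
  · obtain ⟨x, hx, hx0⟩ := Submodule.exists_mem_ne_zero_of_ne_bot hJ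
    exact ⟨x, hx, 0, zero_mem _, hx0⟩
  · have h1 : (-1 : R) ∈ Ring.jacobson R := by
      rw [← SetLike.mem_coe, htop]
      trivial
    simpa using isUnit_one.add_mem_jacobson h1

/-- Additive characters are eigenvectors of the unitary Cayley graph. -/
theorem unitaryCayleyGraph_adjMatrix_mulVec_addChar {R : Type*} [Ring R] [Nontrivial R]
    [Fintype R] [DecidableRel (unitaryCayleyGraph R).Adj] [DecidablePred fun x : R ↦ IsUnit x]
    (χ : AddChar R ℂ) :
    ((unitaryCayleyGraph R).adjMatrix ℂ).mulVec χ =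
      (∑ x, if IsUnit x then χ x else 0) • (χ : R → ℂ) := by
  ext a
  rw [Matrix.mulVec, dotProduct, Pi.smul_apply, smul_eq_mul, Finset.sum_mul,
    ← Equiv.sum_comp (Equiv.addRight a)]
  refine Finset.sum_congr rfl fun x _ ↦ ?_
  have : (unitaryCayleyGraph R).Adj a (x + a) ↔ IsUnit x := by
    rw [SimpleGraph.adj_comm, unitaryCayleyGraph_adj, add_sub_cancel_right]
  simp [SimpleGraph.adjMatrix_apply, this, AddChar.map_add_eq_mul]

/-- If the unitary Cayley graph of a nonzero finite ring is prime, then `0` is not an eigenvalue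
of its adjacency matrix. -/
theorem mainTheorem12 (R : Type*) [Ring R] [Nontrivial R] [Fintype R] [DecidableEq R]
    [DecidableRel (unitaryCayleyGraph R).Adj]
    (hprime : (unitaryCayleyGraph R).IsPrimeGraph) :
    ¬ Module.End.HasEigenvalue
        (Matrix.toLin' ((unitaryCayleyGraph R).adjMatrix ℂ)) 0 := by
  classical
  have : IsSemisimpleRing R :=
    IsArtinianRing.isSemisimpleRing_iff_jacobson.2 (jacobson_eq_bot_of_isPrimeGraph hprime)
  intro h
  obtain ⟨f, hf⟩ := h.exists_hasEigenvector
  refine hf.2 ?_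
  have h0 : ∑ χ : AddChar R ℂ, ((AddChar.complexBasis R).repr f χ *
      ∑ x, if IsUnit x then χ x else 0) • AddChar.complexBasis R χ = 0 := by
    have h1 := hf.apply_eq_smul
    rw [zero_smul, ← (AddChar.complexBasis R).sum_repr f, map_sum] at h1
    rw [← h1]
    refine Finset.sum_congr rfl fun χ _ ↦ ?_
    rw [map_smul, AddChar.complexBasis_apply, Matrix.toLin'_apply,
      unitaryCayleyGraph_adjMatrix_mulVec_addChar, mul_smul]
  have h2 := Fintype.linearIndependent_iff.1 (AddChar.complexBasis R).linearIndependent _ h0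
  rw [← (AddChar.complexBasis R).sum_repr f]
  exact Finset.sum_eq_zero fun χ _ ↦ by
    rw [(mul_eq_zero_iff_right (AddChar.sum_isUnit_ne_zero χ)).1 (h2 χ), zero_smul]
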